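/- Let $k$ be an algebraically closed field of infinite transcendence degree over its prime field. An irreducible variety over $k$ is an integral, separated scheme of finite type over $k$. Let $B$ be an irreducible variety over $k$, let $X \subset B \times_k \mathbb{P}^t_k$ be a closed subscheme, and assume that the projection $f : X \to B$ is flat and that for every closed point $b \in B$ the scheme-theoretic fiber $X_b$ is an irreducible variety. Let $X_0 \subset \mathbb{P}^s_k$ be an irreducible projective variety such that, for every closed point $b \in B$, the fiber $X_b$ is birational to $X_0$ over $k$. Then the family is birationally isotrivial, in both of the following (equivalent) senses: (1) there are a dense open subset $B^0 \subset B$ and a finite cover $B' \to B^0$, that is, a finite surjective morphism from an integral scheme $B'$, such that $X_{B'} = X \times_B B'$ is birational over $B'$ to $B' \times_k X_0$; (2) if $K = k(B)$ is the function field of $B$ and $\overline{K}$ is an algebraic closure of $K$, then the geometric generic fiber $X \times_B \operatorname{Spec} \overline{K}$ is birational over $\overline{K}$ to $X_0 \times_k \operatorname{Spec} \overline{K}$. -/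

import Mathlib

open CategoryTheory CategoryTheory.Limits AlgebraicGeometry

universe u

attribute [local instance] MvPolynomial.gradedAlgebra

/-- Projective space `ℙ^t` over a field `k`: the scheme `Proj k[x₀, …, x_t]`. -/
noncomputable def projSpace (k : Type u) [Field k] (t : ℕ) : Scheme.{u} :=
  Proj (MvPolynomial.homogeneousSubmodule (Fin (t + 1)) k)

/-- The structure morphism `ℙ^t ⟶ Spec k`: the canonical morphism from `Proj A` to `Spec A₀`,
followed by the morphism `Spec A₀ ⟶ Spec k` given by the algebra structure. -/
noncomputable def projSpaceToSpec (k : Type u) [Field k] (t : ℕ) :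
    projSpace k t ⟶ Spec (.of k) :=
  Proj.toSpecZero (MvPolynomial.homogeneousSubmodule (Fin (t + 1)) k) ≫
    Spec.map (CommRingCat.ofHom
      (algebraMap k (MvPolynomial.homogeneousSubmodule (Fin (t + 1)) k 0)))

/-- The product `B × ℙ^t` of a `k`-scheme `B` with projective space, over `k`. -/
noncomputable abbrev prodProjSpace {k : Type u} [Field k] {B : Scheme.{u}}
    (sB : B ⟶ Spec (.of k)) (t : ℕ) : Scheme.{u} :=
  pullback sB (projSpaceToSpec k t)

/-- An irreducible (algebraic) variety over `k`: an integral scheme which is separated and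
of finite type over `k`. -/
structure IsIrreducibleVariety {k : Type u} [Field k] {X : Scheme.{u}}
    (sX : X ⟶ Spec (.of k)) : Prop where
  isIntegral : IsIntegral X
  isSeparated : IsSeparated sX
  locallyOfFiniteType : LocallyOfFiniteType sX
  quasiCompact : QuasiCompact sX

/-- `k` has infinite transcendence degree over its prime field. -/
def HasInfiniteTrdeg (k : Type u) [Field k] : Prop :=
  Cardinal.aleph0 ≤ Algebra.trdeg (⊥ : Subfield k) k

/-- First form of birational isotriviality of `f : X ⟶ B` with model `X₀`: there are a dense open
subset `B⁰` of `B` and a finite cover `p : B' ⟶ B⁰` (a finite surjective morphism from an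
integral scheme) such that `X ×_B B'` is birational to `B' ×_k X₀` over `B'`. -/
def BirationallyTrivialOnFiniteCover {k : Type u} [Field k] {B X X₀ : Scheme.{u}}
    (sB : B ⟶ Spec (.of k)) (f : X ⟶ B) (s₀ : X₀ ⟶ Spec (.of k)) : Prop :=
  ∃ (B₀ : B.Opens) (_ : Dense (B₀ : Set B)) (B' : Scheme.{u}) (p : B' ⟶ B₀.toScheme),
    IsIntegral B' ∧ IsFinite p ∧ Surjective p ∧
      Scheme.BirationalOver
        (pullback.snd f (p ≫ B₀.ι) : pullback f (p ≫ B₀.ι) ⟶ B')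
        (pullback.fst (p ≫ B₀.ι ≫ sB) s₀ : pullback (p ≫ B₀.ι ≫ sB) s₀ ⟶ B')

/-- The geometric generic point `Spec K̄ ⟶ B` of an integral scheme `B`, where `K̄` is an
algebraic closure of the function field `K` of `B`. -/
noncomputable def geomGenericPoint (B : Scheme.{u}) [IsIntegral B] :
    Spec (.of (AlgebraicClosure B.functionField)) ⟶ B :=
  Spec.map (CommRingCat.ofHom
      (algebraMap B.functionField (AlgebraicClosure B.functionField))) ≫
    B.fromSpecStalk (genericPoint B)

/-- Second form of birational isotriviality of `f : X ⟶ B` with model `X₀`: the geometric generic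
fibre `X ×_B Spec K̄` is birational to `X₀ ×_k Spec K̄` over `K̄`. -/
def GeomGenericFiberBirational {k : Type u} [Field k] {B X X₀ : Scheme.{u}} [IsIntegral B]
    (sB : B ⟶ Spec (.of k)) (f : X ⟶ B) (s₀ : X₀ ⟶ Spec (.of k)) : Prop :=
  Scheme.BirationalOver
    (pullback.snd f (geomGenericPoint B))
    (pullback.snd s₀ (geomGenericPoint B ≫ sB))

/-! The geometric generic fibre is, up to a field isomorphism, a closed fibre. Let `Spec R` be an
affine chart of `B` and `E` an algebraic closure of `k(B)`. Finitely many affine charts of `X` over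
`Spec R`, and their overlaps, are described by finitely many elements of `R`; these, a presentation
of `R` and the equations of `X₀` involve finitely many constants, which generate a field `k₀`. As
`trdeg k₀ k` is infinite and `trdeg k E` finite, `k` and `E` have the same transcendence degree over
`k₀`, so there is a `k₀`-isomorphism `σ : k ≃ E`. Moving the coordinates of the generic point to `k`
by `σ⁻¹` gives a closed point `b` at which the chosen elements of `R` take the values that `σ` sends
to the generic ones (`exists_algHom_ringEquiv`). Hence the geometric generic fibre shares a dense
chart with the twist of `X_b` by `σ` (`exists_finite_forall_birationalOver`). The twist of `X_b` is
birational to that of `X₀`, and the latter to `X₀ ×_k E` because `σ` fixes the constants of `X₀`.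
This is (2).

For (1), the birational map over `E` amounts to a common localization of two charts `E ⊗ A` and `E ⊗
A₀`. It involves finitely many elements of `E`, so it already exists over a subalgebra `T` that is
finite over a localization `R_r` (`exists_finite_forall_common_localization`,
`exists_ne_zero_forall_isIntegral`). Then `Spec T` is the finite cover. The descended charts are
dense by flatness and irreducibility of the geometric generic fibre
(`isDominant_of_flat_of_irreducibleSpace`). -/

/-! ### Transcendence degree and the choice of a closed point -/

/-- An isomorphism of algebras extends to algebraic closures. -/
theorem nonempty_algEquiv_of_isAlgClosure (F A B K L : Type*) [Field F] [CommRing A] [CommRing B]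
    [Field K] [Field L] [Algebra F A] [Algebra F B] [Algebra F K] [Algebra F L] [Algebra A K]
    [Algebra B L] [IsScalarTower F A K] [IsScalarTower F B L] [IsDomain A] [IsDomain B]
    [Module.IsTorsionFree A K] [Module.IsTorsionFree B L]
    [IsAlgClosure A K] [IsAlgClosure B L] (e : A ≃ₐ[F] B) : Nonempty (K ≃ₐ[F] L) := by
  refine ⟨AlgEquiv.ofRingEquiv (f := IsAlgClosure.equivOfEquiv K L e.toRingEquiv) fun x => ?_⟩
  rw [IsScalarTower.algebraMap_apply F A K, IsAlgClosure.equivOfEquiv_algebraMap,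
    IsScalarTower.algebraMap_apply F B L]
  exact congrArg _ (e.commutes x)

/-- Algebraically closed extensions of a field with equal transcendence degree are isomorphic. -/
theorem nonempty_algEquiv_of_trdeg_eq (F K L : Type u) [Field F] [Field K] [Field L]
    [Algebra F K] [Algebra F L] [IsAlgClosed K] [IsAlgClosed L]
    (h : Algebra.trdeg F K = Algebra.trdeg F L) : Nonempty (K ≃ₐ[F] L) := by
  obtain ⟨s, hs⟩ := exists_isTranscendenceBasis F K
  obtain ⟨t, ht⟩ := exists_isTranscendenceBasis F L
  have : Cardinal.mk s = Cardinal.mk t := by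
    rw [hs.cardinalMk_eq_trdeg, ht.cardinalMk_eq_trdeg, h]
  obtain ⟨e⟩ := Cardinal.eq.mp this
  have := IsAlgClosed.isAlgClosure_of_transcendence_basis _ hs
  have := IsAlgClosed.isAlgClosure_of_transcendence_basis _ ht
  exact nonempty_algEquiv_of_isAlgClosure F (Algebra.adjoin F (Set.range ((↑) : s → K)))
    (Algebra.adjoin F (Set.range ((↑) : t → L))) K L
    (hs.1.aevalEquiv.symm.trans ((MvPolynomial.renameEquiv F e).trans ht.1.aevalEquiv))

/-- Transcendence degree is additive in towers, and the lower step has finite degree. -/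
theorem aleph0_le_trdeg_adjoin {F k : Type u} [Field F] [Field k] [Algebra F k]
    (hk : Cardinal.aleph0 ≤ Algebra.trdeg F k) {T : Set k} (hT : T.Finite) :
    Cardinal.aleph0 ≤ Algebra.trdeg (IntermediateField.adjoin F T) k := by
  have : Algebra.EssFiniteType F (IntermediateField.adjoin F T) :=
    IntermediateField.essFiniteType_iff.mpr (IntermediateField.fg_adjoin_of_finite hT)
  have h1 := trdeg_lt_aleph0 F (IntermediateField.adjoin F T)
  by_contra! h2
  have := Cardinal.add_lt_aleph0 h1 h2
  rw [trdeg_add_eq] at this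
  exact absurd hk this.not_ge

/-- If `R` is a finitely generated domain over an algebraically closed field `k` of infinite
transcendence degree, and `E` is an algebraic closure of its fraction field, then on any finite
subset of `R` the generic point looks like a `k`-point, up to an isomorphism `k ≃ E`. -/
theorem exists_algHom_ringEquiv {k : Type u} [Field k] [IsAlgClosed k] (hk : HasInfiniteTrdeg k)
    {R E : Type u} [CommRing R] [IsDomain R] [Algebra k R] [Algebra.FiniteType k R]
    [Field E] [IsAlgClosed E] [Algebra R E] [Algebra k E] [IsScalarTower k R E]
    [FaithfulSMul R E] [Algebra.IsAlgebraic R E] {S : Set R} (hS : S.Finite) :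
    ∃ (b : R →ₐ[k] k) (σ : k ≃+* E), ∀ s ∈ S, σ (b s) = algebraMap R E s := by
  obtain ⟨n, π, hπ⟩ := Algebra.FiniteType.iff_quotient_mvPolynomial''.mp
    (‹_› : Algebra.FiniteType k R)
  obtain ⟨G, hG⟩ := IsNoetherian.noetherian (RingHom.ker π)
  choose l hl using hπ
  -- The relations must have constants fixed by `σ` for the new point to satisfy them; the lifts of
  -- `S` must too, for the values on `S` to correspond.
  let T : Set k := (⋃ g ∈ G, (g.coeffs : Set k)) ∪ ⋃ s ∈ S, ((l s).coeffs : Set k)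
  have hT : T.Finite := by
    refine Set.Finite.union ?_ ?_
    · exact Set.Finite.biUnion G.finite_toSet fun g _ => Finset.finite_toSet _
    · exact Set.Finite.biUnion hS fun g _ => Finset.finite_toSet _
  let k₀ := IntermediateField.adjoin (⊥ : Subfield k) T
  have h1 : Algebra.trdeg k₀ k = Algebra.trdeg k₀ E := by
    have h2 : Algebra.trdeg k E < Cardinal.aleph0 := by
      have := trdeg_add_eq k R (A := E)
      rw [trdeg_eq_zero_iff.2 (‹_› : Algebra.IsAlgebraic R E), add_zero] at this
      rw [← this]
      exact trdeg_lt_aleph0_of_finiteType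
    have h3 := aleph0_le_trdeg_adjoin hk hT
    rw [← trdeg_add_eq k₀ k (A := E), Cardinal.add_eq_left h3 (h2.le.trans h3)]
  obtain ⟨σ⟩ := nonempty_algEquiv_of_trdeg_eq k₀ k E h1
  -- The coordinates of the generic point, carried back to `k`.
  let a : Fin n → k := fun i => σ.symm (algebraMap R E (π (MvPolynomial.X i)))
  have key : ∀ p : MvPolynomial (Fin n) k, (p.coeffs : Set k) ⊆ T →
      σ (MvPolynomial.aeval a p) = algebraMap R E (π p) := by
    intro p hp
    have e1 : σ (MvPolynomial.aeval a p) = MvPolynomial.eval₂ (σ : k →+* E)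
        (fun i => algebraMap R E (π (MvPolynomial.X i))) p := by
      rw [MvPolynomial.aeval_def]
      have := MvPolynomial.eval₂_comp_left (σ : k →+* E) (algebraMap k k) a p
      simpa [a, Function.comp_def] using! this
    have e2 : algebraMap R E (π p) = MvPolynomial.eval₂ (algebraMap k E)
        (fun i => algebraMap R E (π (MvPolynomial.X i))) p := by
      have : (IsScalarTower.toAlgHom k R E).comp π = MvPolynomial.aeval
          (fun i => algebraMap R E (π (MvPolynomial.X i))) := by
        ext i; simp
      simpa [MvPolynomial.aeval_def] using DFunLike.congr_fun this p
    rw [e1, e2, MvPolynomial.eval₂_eq, MvPolynomial.eval₂_eq]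
    refine Finset.sum_congr rfl fun d hd => ?_
    congr 1
    have hc : p.coeff d ∈ T := hp (MvPolynomial.coeff_mem_coeffs _ (by simpa using hd))
    have := σ.commutes ⟨p.coeff d, IntermediateField.subset_adjoin _ _ hc⟩
    rwa [IsScalarTower.algebraMap_apply k₀ k E] at this
  have hker : ∀ p, π p = 0 → MvPolynomial.aeval a p = 0 := by
    have : RingHom.ker π ≤ RingHom.ker (MvPolynomial.aeval (R := k) a) := by
      rw [← hG, Ideal.submodule_span_eq, Ideal.span_le]
      intro g hg
      have hg0 : π g = 0 := by
        have : g ∈ RingHom.ker π := hG ▸ Submodule.subset_span hg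
        exact this
      have := key g (fun c hc => Or.inl (Set.mem_biUnion hg hc))
      rw [hg0, map_zero] at this
      simpa using this
    exact this
  have hπ : Function.Surjective π := fun r => ⟨l r, hl r⟩
  refine ⟨(Ideal.Quotient.liftₐ (RingHom.ker π) (MvPolynomial.aeval a) hker).comp
    (Ideal.quotientKerAlgEquivOfSurjective hπ).symm.toAlgHom, σ.toRingEquiv, fun s hs => ?_⟩
  have : (Ideal.quotientKerAlgEquivOfSurjective hπ).symm s = Ideal.Quotient.mk _ (l s) := by
    rw [AlgEquiv.symm_apply_eq]
    exact (hl s).symm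
  have h2 := key (l s) (fun c hc => Or.inr (Set.mem_biUnion hs hc))
  rw [hl] at h2
  simpa [this, Ideal.Quotient.liftₐ_apply] using! h2

/-! ### Fibres determined by finitely many elements of the base ring -/

/-- A morphism of affine schemes of finite presentation is the base change of a morphism
to `Spec R₀`, with `R₀` a subring of `R` generated by finitely many elements. -/
theorem exists_finite_isPullback_adjoin {R A : CommRingCat.{u}} (φ : R ⟶ A)
    (hφ : φ.hom.FinitePresentation) :
    ∃ S : Set R, S.Finite ∧ ∃ (M : Scheme.{u}) (g : M ⟶ Spec (.of (Algebra.adjoin ℤ S)))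
      (h : Spec A ⟶ M), IsPullback h (Spec.map φ) g
        (Spec.map (CommRingCat.ofHom (algebraMap (Algebra.adjoin ℤ S) R))) := by
  algebraize [φ.hom]
  let P := Algebra.Presentation.ofFinitePresentation R A
  let R₀ := Algebra.adjoin ℤ P.coeffs
  have : P.HasCoeffs R₀ := inferInstanceAs (P.HasCoeffs P.Core)
  refine ⟨P.coeffs, P.finite_coeffs, Spec (.of (P.ModelOfHasCoeffs R₀)),
    Spec.map (CommRingCat.ofHom (algebraMap R₀ _)),
    Spec.map (CommRingCat.ofHom ((P.tensorModelOfHasCoeffsEquiv R₀).toRingEquiv.toRingHom.comp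
      Algebra.TensorProduct.includeRight.toRingHom)), ?_⟩
  have h := CommRingCat.isPushout_tensorProduct R₀ R (P.ModelOfHasCoeffs R₀)
  refine (isPullback_SpecMap_of_isPushout _ _ _ _ (h.of_iso (Iso.refl _) (Iso.refl _) (Iso.refl _)
    (P.tensorModelOfHasCoeffsEquiv R₀).toRingEquiv.toCommRingCatIso ?_ ?_ ?_ ?_)).flip
  · rfl
  · rfl
  · ext x
    exact (P.tensorModelOfHasCoeffsEquiv R₀).commutes x
  · rfl

/-- Base changes of a finitely presented morphism of affine schemes along two homomorphisms
which agree on a suitable finite set are isomorphic. -/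
theorem exists_finite_forall_iso_pullback {R : CommRingCat.{u}} [IsNoetherianRing R]
    {W : Scheme.{u}} [IsAffine W] (f : W ⟶ Spec R) [LocallyOfFiniteType f] :
    ∃ S : Set R, S.Finite ∧ ∀ (E : CommRingCat.{u}) (x y : R ⟶ E), (∀ s ∈ S, x s = y s) →
      ∃ e : pullback f (Spec.map x) ≅ pullback f (Spec.map y),
        e.hom ≫ pullback.snd _ _ = pullback.snd _ _ := by
  obtain ⟨φ, hφ⟩ := Spec.map_surjective (W.isoSpec.inv ≫ f)
  have hft : φ.hom.FiniteType := by
    rw [← HasRingHomProperty.Spec_iff (P := @LocallyOfFiniteType), hφ]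
    infer_instance
  obtain ⟨S, hS, M, g, h, H⟩ := exists_finite_isPullback_adjoin φ
    (RingHom.FinitePresentation.of_finiteType.mp hft)
  refine ⟨S, hS, fun E x y hxy => ?_⟩
  have H' : IsPullback (W.isoSpec.hom ≫ h) f g
      (Spec.map (CommRingCat.ofHom (algebraMap (Algebra.adjoin ℤ S) R))) :=
    H.of_iso W.isoSpec.symm (Iso.refl _) (Iso.refl _) (Iso.refl _) (by simp) (by simp [hφ])
      (by simp) (by simp)
  -- Ring homomorphisms are `ℤ`-linear, so agreement on `S` gives agreement on the subring it
  -- generates; both pullbacks are then base changes of `M` along one map.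
  have hR₀ : CommRingCat.ofHom (algebraMap (Algebra.adjoin ℤ S) R) ≫ x =
      CommRingCat.ofHom (algebraMap (Algebra.adjoin ℤ S) R) ≫ y := by
    have : (x.hom.toIntAlgHom.comp (Algebra.adjoin ℤ S).val) =
        (y.hom.toIntAlgHom.comp (Algebra.adjoin ℤ S).val) := by
      refine AlgHom.adjoin_ext fun s hs => hxy s hs
    ext s
    exact DFunLike.congr_fun this s
  have hx := (IsPullback.of_hasPullback f (Spec.map x)).paste_horiz H'
  have hy := (IsPullback.of_hasPullback f (Spec.map y)).paste_horiz H'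
  rw [← Spec.map_comp] at hx hy
  rw [hR₀] at hx
  exact ⟨hx.isoIsPullback _ _ hy, by simp⟩

section

open TopologicalSpace

theorem TopologicalSpace.IsOpenCover.irreducibleSpace {X ι : Type*} [TopologicalSpace X]
    [Nonempty X] {U : ι → Opens X} (hU : IsOpenCover U) (h : ∀ i, IsPreirreducible (U i : Set X))
    (hn : ∀ i j, (U i : Set X).Nonempty → (U j : Set X).Nonempty →
      (U i ∩ U j : Set X).Nonempty) : IrreducibleSpace X where
  toPreirreducibleSpace := by
    refine PreirreducibleSpace.of_forall_nonempty_inter fun u v hu hv ⟨a, ha⟩ ⟨b, hb⟩ => ?_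
    obtain ⟨i, hi⟩ := hU.exists_mem a
    obtain ⟨j, hj⟩ := hU.exists_mem b
    obtain ⟨c, hci, hcu, hcj⟩ := h i u (U j) hu (U j).isOpen ⟨a, hi, ha⟩ (hn i j ⟨a, hi⟩ ⟨b, hj⟩)
    obtain ⟨d, -, hd⟩ := h j u v hu hv ⟨c, hcj, hcu⟩ ⟨b, hj, hb⟩
    exact ⟨d, hd⟩
  toNonempty := inferInstance

/-- The part of a base change lying over an open subset `U` is the base change of `U`. -/
theorem isPullback_preimage_fst {Z S T : Scheme.{u}} (f : Z ⟶ S) (x : T ⟶ S) (U : Z.Opens) :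
    IsPullback (pullback.fst f x ∣_ U) ((pullback.fst f x ⁻¹ᵁ U).ι ≫ pullback.snd f x)
      (U.ι ≫ f) x :=
  ((isPullback_morphismRestrict _ U).flip.paste_horiz (IsPullback.of_hasPullback f x).flip).flip

/-- No compatibility is claimed between the isomorphisms for different `U`: birationality needs just
one chart. -/
theorem exists_finite_forall_iso_preimage {R : CommRingCat.{u}} [IsNoetherianRing R]
    {Z : Scheme.{u}} (f : Z ⟶ Spec R) [LocallyOfFiniteType f] {U : Z.Opens} (hU : IsAffineOpen U) :
    ∃ S : Set R, S.Finite ∧ ∀ (E : CommRingCat.{u}) (x y : R ⟶ E), (∀ s ∈ S, x s = y s) →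
      ∃ e : (pullback.fst f (Spec.map x) ⁻¹ᵁ U).toScheme ≅
          (pullback.fst f (Spec.map y) ⁻¹ᵁ U).toScheme,
        e.hom ≫ (pullback.fst f (Spec.map y) ⁻¹ᵁ U).ι ≫ pullback.snd _ _ =
          (pullback.fst f (Spec.map x) ⁻¹ᵁ U).ι ≫ pullback.snd _ _ := by
  have : IsAffine U := hU
  obtain ⟨S, hS, H⟩ := exists_finite_forall_iso_pullback (U.ι ≫ f)
  refine ⟨S, hS, fun E x y hxy => ?_⟩
  obtain ⟨e, he⟩ := H E x y hxy
  refine ⟨(isPullback_preimage_fst f (Spec.map x) U).isoPullback ≪≫ e ≪≫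
    (isPullback_preimage_fst f (Spec.map y) U).isoPullback.symm, ?_⟩
  simp [he]

/-- Let `Z` be separated of finite type over a noetherian ring `R`. If two ring homomorphisms
`x y : R ⟶ E` agree on a suitable finite set and the base change of `Z` along `y` is irreducible,
then so is the one along `x`, and the two are birational over `E`. -/
theorem exists_finite_forall_birationalOver {R : CommRingCat.{u}} [IsNoetherianRing R]
    {Z : Scheme.{u}} (f : Z ⟶ Spec R) [LocallyOfFiniteType f] [QuasiCompact f] [IsSeparated f] :
    ∃ S : Set R, S.Finite ∧ ∀ (E : CommRingCat.{u}) (x y : R ⟶ E), (∀ s ∈ S, x s = y s) →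
      IrreducibleSpace ↥(pullback f (Spec.map y)) →
        IrreducibleSpace ↥(pullback f (Spec.map x)) ∧
        Scheme.BirationalOver (pullback.snd f (Spec.map x)) (pullback.snd f (Spec.map y)) := by
  have : Z.IsSeparated := ⟨by rw [← terminal.comp_from f]; infer_instance⟩
  have : CompactSpace Z := QuasiCompact.compactSpace_of_compactSpace f
  let 𝒰 := Z.affineCover.finiteSubcover
  let U : 𝒰.I₀ → Z.Opens := fun i => (𝒰.f i).opensRange
  have hcov : IsOpenCover U := 𝒰.isOpenCover_opensRange
  have hU : ∀ i, IsAffineOpen (U i) := fun i => isAffineOpen_opensRange (𝒰.f i)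
  -- Overlaps are affine by separatedness. They serve only to transfer nonemptiness of
  -- intersections, whence irreducibility.
  choose S hS hSU using fun p : 𝒰.I₀ × 𝒰.I₀ =>
    exists_finite_forall_iso_preimage f ((hU p.1).inf (hU p.2))
  refine ⟨⋃ p, S p, Set.finite_iUnion hS, fun E x y hxy hy => ?_⟩
  replace hSU := fun i j => hSU (i, j) E x y fun s hs => hxy s (Set.mem_iUnion_of_mem _ hs)
  let Ux : 𝒰.I₀ → (pullback f (Spec.map x)).Opens := fun i => pullback.fst f (Spec.map x) ⁻¹ᵁ U i
  let Uy : 𝒰.I₀ → (pullback f (Spec.map y)).Opens := fun i => pullback.fst f (Spec.map y) ⁻¹ᵁ U i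
  have hcovx : IsOpenCover Ux := hcov.comap (pullback.fst f (Spec.map x)).base.hom
  have hcovy : IsOpenCover Uy := hcov.comap (pullback.fst f (Spec.map y)).base.hom
  have e : ∀ i, ∃ e : (Ux i).toScheme ≅ (Uy i).toScheme,
      e.hom ≫ (Uy i).ι ≫ pullback.snd _ _ = (Ux i).ι ≫ pullback.snd _ _ := fun i => by
    have := hSU i i
    rwa [inf_idem] at this
  choose e he using e
  have hxy2 : ∀ i j, (Uy i ∩ Uy j : Set ↥(pullback f (Spec.map y))).Nonempty →
      (Ux i ∩ Ux j : Set ↥(pullback f (Spec.map x))).Nonempty := by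
    rintro i j ⟨a, ha⟩
    obtain ⟨e, -⟩ := hSU i j
    exact ⟨_, (e.inv ⟨a, ha⟩).2⟩
  have hyx1 : ∀ i, (Ux i : Set ↥(pullback f (Spec.map x))).Nonempty →
      (Uy i : Set ↥(pullback f (Spec.map y))).Nonempty := by
    rintro i ⟨a, ha⟩
    exact ⟨_, ((e i).hom ⟨a, ha⟩).2⟩
  obtain ⟨z⟩ : Nonempty ↥(pullback f (Spec.map y)) := inferInstance
  obtain ⟨i, hi⟩ := hcovy.exists_mem z
  have hxi : (Ux i : Set ↥(pullback f (Spec.map x))).Nonempty := ⟨_, ((e i).inv ⟨z, hi⟩).2⟩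
  have : Nonempty ↥(pullback f (Spec.map x)) := ⟨hxi.some⟩
  have hpre : ∀ i, IsPreirreducible (Ux i : Set ↥(pullback f (Spec.map x))) := fun i => by
    have : PreirreducibleSpace (Uy i) :=
      (Uy i).isOpenEmbedding.preirreducibleSpace
    have : PreirreducibleSpace (Ux i) :=
      (e i).hom.isOpenEmbedding.preirreducibleSpace
    exact @IsPreirreducible.of_subtype _ _ _ this
  have hirr : IrreducibleSpace ↥(pullback f (Spec.map x)) :=
    hcovx.irreducibleSpace hpre fun i j hi hj => hxy2 i j
      (nonempty_preirreducible_inter (Uy i).isOpen (Uy j).isOpen (hyx1 i hi) (hyx1 j hj))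
  exact ⟨hirr, ⟨Ux i, (Ux i).isOpen.dense hxi, Uy i, (Uy i).isOpen.dense ⟨z, hi⟩, e i⟩, he i⟩

end

/-! ### Formal properties of birational equivalence -/

namespace AlgebraicGeometry.Scheme

theorem PartialIso.irreducibleSpace {X Y : Scheme.{u}} (e : PartialIso X Y) [IrreducibleSpace X] :
    IrreducibleSpace Y := by
  have : Nonempty e.source := e.dense_source.nonempty.to_subtype
  have : PreirreducibleSpace e.source := e.source.isOpenEmbedding.preirreducibleSpace
  have : Nonempty Y := ⟨(e.iso.hom (Classical.arbitrary _)).1⟩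
  have h : PreirreducibleSpace e.target := e.iso.inv.isOpenEmbedding.preirreducibleSpace
  have h' : IsPreirreducible (e.target : Set Y) := @IsPreirreducible.of_subtype _ _ _ h
  refine { isPreirreducible_univ := ?_, toNonempty := this }
  rw [← e.dense_target.closure_eq]
  exact h'.closure

namespace BirationalOver

theorem irreducibleSpace {S X Y : Scheme.{u}} {sX : X ⟶ S} {sY : Y ⟶ S}
    (h : BirationalOver sX sY) [IrreducibleSpace X] : IrreducibleSpace Y :=
  h.choose.irreducibleSpace

theorem comp {S T X Y : Scheme.{u}} {sX : X ⟶ S} {sY : Y ⟶ S} (h : BirationalOver sX sY)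
    (g : S ⟶ T) : BirationalOver (sX ≫ g) (sY ≫ g) := by
  obtain ⟨e, he⟩ := h
  refine ⟨e, ?_⟩
  simpa using congr($he ≫ g)

theorem of_iso {S X Y : Scheme.{u}} {sX : X ⟶ S} {sY : Y ⟶ S} (e : X ≅ Y)
    (h : e.hom ≫ sY = sX) : BirationalOver sX sY :=
  Hom.birationalOver e.hom sY sX h

/-- Base change along an isomorphism amounts to changing the structure morphism. -/
theorem pullback_isIso_comp {X B S T : Scheme.{u}} (f : X ⟶ B) (c : S ⟶ B) (g : T ⟶ S) [IsIso g] :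
    BirationalOver (pullback.snd f (g ≫ c)) (pullback.snd f c ≫ inv g) := by
  refine .of_iso (asIso (pullback.map f (g ≫ c) f c (𝟙 _) g (𝟙 _) (by simp) (by simp))) ?_
  rw [asIso_hom, pullback.lift_snd_assoc, Category.assoc, IsIso.hom_inv_id, Category.comp_id]

/-- Base change in two steps. -/
theorem pullback_comp {X B S T : Scheme.{u}} (f : X ⟶ B) (c : S ⟶ B) (g : T ⟶ S) :
    BirationalOver (pullback.snd f (g ≫ c)) (pullback.snd (pullback.snd f c) g) :=
  .of_iso (pullbackLeftPullbackSndIso f c g).symm (by simp)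

end BirationalOver

end AlgebraicGeometry.Scheme

/-! ### From closed fibres to the geometric generic fibre -/

/-- A rational point of a separated scheme over a field is closed, and the fibre over it is the
base change along the corresponding section. -/
theorem isClosed_and_exists_iso_fiber {k : Type u} [Field k] {B X : Scheme.{u}}
    (sB : B ⟶ Spec (.of k)) [IsSeparated sB] (f : X ⟶ B) (c : Spec (.of k) ⟶ B)
    (hc : c ≫ sB = 𝟙 _) :
    ∃ b : B, IsClosed {b} ∧ ∃ e : pullback f c ≅ f.fiber b,
      e.hom ≫ f.fiberι b ≫ f ≫ sB = pullback.snd f c := by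
  have : IsClosedImmersion (c ≫ sB) := by rw [hc]; infer_instance
  have : IsClosedImmersion c := .of_comp c sB
  let z : Spec (.of k) := IsLocalRing.closedPoint k
  refine ⟨c z, ?_, ?_⟩
  · have := c.isClosedEmbedding.isClosed_range
    convert this
    ext y
    constructor
    · rintro rfl
      exact ⟨z, rfl⟩
    · rintro ⟨z', rfl⟩
      rw [Subsingleton.elim z' z]; rfl
  · let d : Spec (.of k) ⟶ Spec (B.residueField (c z)) :=
      Spec.map (B.descResidueField (Scheme.stalkClosedPointTo c))
    have hd : d ≫ B.fromSpecResidueField (c z) = c :=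
      B.descResidueField_stalkClosedPointTo_fromSpecResidueField k c
    obtain ⟨ψ, hψ⟩ := Spec.map_surjective (B.fromSpecResidueField (c z) ≫ sB)
    -- The structure map splits the map from the residue field to `k`, which is therefore
    -- surjective, hence an isomorphism.
    have hψd : ψ ≫ B.descResidueField (Scheme.stalkClosedPointTo c) = 𝟙 _ := by
      apply Spec.map_injective
      rw [Spec.map_comp, hψ, Spec.map_id, ← hc]
      exact (Category.assoc _ _ _).symm.trans congr($hd ≫ sB)
    have : IsIso (B.descResidueField (Scheme.stalkClosedPointTo c)) := by
      rw [ConcreteCategory.isIso_iff_bijective]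
      refine ⟨RingHom.injective _, fun a => ⟨ψ a, ?_⟩⟩
      exact DFunLike.congr_fun congr($(hψd).hom) a
    have : IsIso d := inferInstanceAs (IsIso (Spec.map _))
    let m : pullback f c ⟶ f.fiber (c z) :=
      pullback.map _ _ _ _ (𝟙 _) d (𝟙 _) (by simp) (by rw [Category.comp_id, hd])
    have hm : m ≫ f.fiberι (c z) = pullback.fst f c :=
      (pullback.lift_fst _ _ _).trans (Category.comp_id _)
    have : IsIso m := inferInstanceAs (IsIso (pullback.map _ _ _ _ _ _ _ _ _))
    refine ⟨asIso m, ?_⟩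
    rw [asIso_hom, reassoc_of% hm, pullback.condition_assoc, hc, Category.comp_id]

/-- The geometric generic fibre of a family whose closed fibres are all irreducible and birational
to `X₀` is itself irreducible and birational to `X₀`. -/
theorem irreducibleSpace_and_birationalOver_of_forall_isClosed {k : Type u} [Field k]
    [IsAlgClosed k] (hk : HasInfiniteTrdeg k)
    {R E : Type u} [CommRing R] [IsDomain R] [Algebra k R] [Algebra.FiniteType k R]
    [Field E] [IsAlgClosed E] [Algebra R E] [Algebra k E] [IsScalarTower k R E]
    [FaithfulSMul R E] [Algebra.IsAlgebraic R E]
    {B X X₀ : Scheme.{u}} (sB : B ⟶ Spec (.of k)) [IsSeparated sB]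
    (ι : Spec (.of R) ⟶ B) (hι : ι ≫ sB = Spec.map (CommRingCat.ofHom (algebraMap k R)))
    (f : X ⟶ B) [LocallyOfFiniteType f] [QuasiCompact f] [IsSeparated f]
    (s₀ : X₀ ⟶ Spec (.of k)) [LocallyOfFiniteType s₀] [QuasiCompact s₀] [IsSeparated s₀]
    [IrreducibleSpace X₀]
    (hbir : ∀ b : B, IsClosed {b} → Scheme.BirationalOver (f.fiberι b ≫ f ≫ sB) s₀) :
    IrreducibleSpace ↥(pullback f (Spec.map (CommRingCat.ofHom (algebraMap R E)) ≫ ι)) ∧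
    Scheme.BirationalOver
      (pullback.snd f (Spec.map (CommRingCat.ofHom (algebraMap R E)) ≫ ι))
      (pullback.snd s₀ (Spec.map (CommRingCat.ofHom (algebraMap k E)))) := by
  have : IsNoetherianRing R := Algebra.FiniteType.isNoetherianRing k R
  have : IsNoetherianRing (CommRingCat.of R) := ‹_›
  have : IsNoetherianRing (CommRingCat.of k) := inferInstanceAs (IsNoetherianRing k)
  obtain ⟨S, hS, H⟩ := exists_finite_forall_birationalOver (pullback.snd f ι)
  obtain ⟨S₀, hS₀, H₀⟩ := exists_finite_forall_birationalOver s₀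
  -- `σ` is not `k`-linear. As `b` is, including the image of `S₀` makes `σ` agree with `k → E` on
  -- `S₀`.
  obtain ⟨b, σ, hσ⟩ := exists_algHom_ringEquiv hk (R := R) (E := E)
    (S := S ∪ algebraMap k R '' S₀) (hS.union (hS₀.image _))
  let τ : CommRingCat.of k ⟶ .of E := CommRingCat.ofHom σ.toRingHom
  have : IsIso τ := inferInstanceAs (IsIso σ.toCommRingCatIso.hom)
  let β : CommRingCat.of R ⟶ .of k := CommRingCat.ofHom b.toRingHom
  have hc : (Spec.map β ≫ ι) ≫ sB = 𝟙 _ := by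
    rw [Category.assoc, hι, ← Spec.map_comp, ← Spec.map_id]
    congr 1
    ext a
    exact b.commutes a
  obtain ⟨z, hz, e, he⟩ := isClosed_and_exists_iso_fiber sB f _ hc
  have h₁ : Scheme.BirationalOver s₀ (pullback.snd f (Spec.map β ≫ ι)) :=
    ((Scheme.BirationalOver.of_iso e he).trans (hbir z hz)).symm
  have h₂ := h₁.comp (inv (Spec.map τ))
  have h₃ : Scheme.BirationalOver (pullback.snd (pullback.snd f ι) (Spec.map (β ≫ τ)))
      (pullback.snd f (Spec.map β ≫ ι) ≫ inv (Spec.map τ)) := by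
    refine .trans (Scheme.BirationalOver.pullback_comp f ι (Spec.map (β ≫ τ))).symm ?_
    rw [Spec.map_comp, Category.assoc]
    exact .pullback_isIso_comp f _ _
  have h₄ : Scheme.BirationalOver (pullback.snd s₀ (Spec.map τ)) (s₀ ≫ inv (Spec.map τ)) := by
    have := Scheme.BirationalOver.pullback_isIso_comp s₀ (𝟙 _) (Spec.map τ)
    rw [Category.comp_id] at this
    exact this.trans (.comp (.of_iso (asIso (pullback.fst s₀ (𝟙 _)))
      (by simp [pullback.condition])) _)
  have h₅ : IrreducibleSpace ↥(pullback s₀ (Spec.map τ)) := h₄.symm.irreducibleSpace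
  have h₆ : IrreducibleSpace ↥(pullback (pullback.snd f ι) (Spec.map (β ≫ τ))) :=
    (h₂.trans h₃.symm).irreducibleSpace
  obtain ⟨h₇, h₈⟩ := H _ (CommRingCat.ofHom (algebraMap R E)) (β ≫ τ)
    (fun s hs => (hσ s (Or.inl hs)).symm) h₆
  obtain ⟨-, h₉⟩ := H₀ _ (CommRingCat.ofHom (algebraMap k E)) τ (fun s hs => by
    have := hσ _ (Or.inr ⟨s, hs, rfl⟩)
    rw [AlgHom.commutes, ← IsScalarTower.algebraMap_apply] at this
    exact this.symm) h₅
  have h₁₀ := Scheme.BirationalOver.pullback_comp f ι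
    (Spec.map (CommRingCat.ofHom (algebraMap R E)))
  exact ⟨h₁₀.symm.irreducibleSpace, h₁₀.trans (h₈.trans (h₃.trans (h₂.symm.trans
    (h₄.symm.trans h₉.symm))))⟩

/-! ### Descent of a common localization to a subalgebra -/

section

open scoped TensorProduct

section AwayRange

variable {T D Ω : Type*} [CommRing T] [CommRing D] [CommRing Ω] [Algebra T D] [Algebra T Ω]

/-- The subalgebra of fractions `v w / v d ^ n`, for an algebra homomorphism `v`. -/
def AlgHom.awayRange (v : D →ₐ[T] Ω) (d : D) : Subalgebra T Ω where
  carrier := {z | ∃ n w, z * v d ^ n = v w}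
  mul_mem' := by
    rintro z z' ⟨n, w, h⟩ ⟨n', w', h'⟩
    exact ⟨n + n', w * w', by rw [map_mul, ← h, ← h']; ring⟩
  add_mem' := by
    rintro z z' ⟨n, w, h⟩ ⟨n', w', h'⟩
    exact ⟨n + n', w * d ^ n' + w' * d ^ n, by
      rw [map_add, map_mul, map_mul, ← h, ← h', map_pow, map_pow]; ring⟩
  algebraMap_mem' r := ⟨0, algebraMap T D r, by simp⟩

namespace AlgHom

theorem apply_mem_awayRange (v : D →ₐ[T] Ω) (d w : D) : v w ∈ v.awayRange d := ⟨0, w, by simp⟩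

theorem awayRange_le {v : D →ₐ[T] Ω} {d : D} {P : Subalgebra T Ω} (h : ∀ w, v w ∈ P)
    {i : Ω} (hi : i ∈ P) (hdi : v d * i = 1) : v.awayRange d ≤ P := by
  rintro z ⟨n, w, hz⟩
  have : z = v w * i ^ n := by rw [← hz, mul_assoc, ← mul_pow, hdi, one_pow, mul_one]
  exact this ▸ P.mul_mem (h w) (P.pow_mem hi n)

/-- The range is `D` localized at `d`: `d` becomes invertible, every element is a fraction, and the
kernel is `d`-power torsion. -/
theorem isStandardOpenImmersion_codRestrict_awayRange (v : D →ₐ[T] Ω) (d : D)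
    (hd : IsUnit (v d)) (hv : ∀ w, v w = 0 → ∃ n : ℕ, d ^ n * w = 0) :
    (v.codRestrict (v.awayRange d)
      (v.apply_mem_awayRange d)).toRingHom.IsStandardOpenImmersion := by
  algebraize [(v.codRestrict (v.awayRange d) (v.apply_mem_awayRange d)).toRingHom]
  refine ⟨d, ?_⟩
  have hval : ∀ w, ((algebraMap D (v.awayRange d) w : v.awayRange d) : Ω) = v w := fun _ => rfl
  refine ⟨?_, ?_, ?_⟩
  · rintro ⟨_, n, rfl⟩
    obtain ⟨i, hi⟩ := hd.exists_right_inv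
    have hi' : i ∈ v.awayRange d := ⟨1, 1, by simp [mul_comm i, hi]⟩
    rw [map_pow]
    exact (IsUnit.of_mul_eq_one ⟨i, hi'⟩ (Subtype.ext hi)).pow n
  · rintro ⟨z, n, w, hz⟩
    exact ⟨⟨w, ⟨_, n, rfl⟩⟩, Subtype.ext (by simpa [hval] using hz)⟩
  · intro x y hxy
    have : v (x - y) = 0 := by
      rw [map_sub, ← hval, ← hval, hxy, sub_self]
    obtain ⟨n, hn⟩ := hv _ this
    exact ⟨⟨_, n, rfl⟩, by simpa [mul_sub, sub_eq_zero] using hn⟩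

end AlgHom

end AwayRange

section Tensor

variable {k R E : Type*} [CommRing k] [CommRing R] [CommRing E] [Algebra k R] [Algebra k E]
  [Algebra R E] [IsScalarTower k R E] (A : Type*) [CommRing A] [Algebra k A]

variable (k) in
/-- The map `T ⊗ A ⟶ E ⊗ A` for a subalgebra `T` of `E`. -/
noncomputable def Subalgebra.tensorVal (T : Subalgebra R E) : T ⊗[k] A →ₐ[T] E ⊗[k] A :=
  Algebra.TensorProduct.map (Algebra.ofId T E) (AlgHom.id k A)

theorem Subalgebra.tensorVal_injective [Module.Flat k A] (T : Subalgebra R E) :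
    Function.Injective (T.tensorVal k A) :=
  Module.Flat.rTensor_preserves_injective_linearMap (M := A)
    ((IsScalarTower.toAlgHom k T E).toLinearMap) Subtype.val_injective

variable (R) in
-- A tensor is a finite sum of pure ones; `C` collects their left factors.
theorem exists_finite_forall_mem_range_tensorVal (w : E ⊗[k] A) :
    ∃ C : Set E, C.Finite ∧ ∀ T : Subalgebra R E, C ⊆ T → w ∈ (T.tensorVal k A).range := by
  induction w with
  | zero => exact ⟨∅, Set.finite_empty, fun T _ => zero_mem _⟩
  | tmul e a =>
    refine ⟨{e}, Set.finite_singleton e, fun T hT => ⟨⟨e, hT rfl⟩ ⊗ₜ a, ?_⟩⟩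
    rfl
  | add x y hx hy =>
    obtain ⟨C, hC, h⟩ := hx
    obtain ⟨C', hC', h'⟩ := hy
    exact ⟨C ∪ C', hC.union hC', fun T hT => add_mem (h T (Set.subset_union_left.trans hT))
      (h' T (Set.subset_union_right.trans hT))⟩

variable {A} {Ω : Type*} [CommRing Ω] [Algebra E Ω]

/-- The restriction of `u : E ⊗ A ⟶ Ω` to `T ⊗ A`. -/
noncomputable def Subalgebra.tensorRestrict (T : Subalgebra R E) (u : E ⊗[k] A →ₐ[E] Ω) :
    T ⊗[k] A →ₐ[T] Ω :=
  (u.restrictScalars T).comp (T.tensorVal k A)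

theorem Subalgebra.tensorRestrict_mem (T : Subalgebra R E) (u : E ⊗[k] A →ₐ[E] Ω)
    {G : Set A} (hG : Algebra.adjoin k G = ⊤) {P : Subalgebra T Ω}
    (hP : ∀ g ∈ G, u (1 ⊗ₜ g) ∈ P) (w : T ⊗[k] A) : T.tensorRestrict u w ∈ P := by
  have h : ∀ a : A, T.tensorRestrict u (1 ⊗ₜ a) ∈ P := by
    intro a
    have ha : a ∈ Algebra.adjoin k G := hG ▸ Algebra.mem_top
    induction ha using Algebra.adjoin_induction with
    | mem g hg => exact hP g hg
    | algebraMap r =>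
      have : (1 : T) ⊗ₜ[k] algebraMap k A r = algebraMap T (T ⊗[k] A) (algebraMap k T r) := by
        rw [Algebra.TensorProduct.algebraMap_apply, Algebra.algebraMap_eq_smul_one,
          Algebra.algebraMap_self_apply, Algebra.algebraMap_eq_smul_one, TensorProduct.smul_tmul]
      rw [this, AlgHom.commutes]
      exact P.algebraMap_mem _
    | add x y _ _ hx hy => rw [TensorProduct.tmul_add, map_add]; exact add_mem hx hy
    | mul x y _ _ hx hy =>
      have : (1 : T) ⊗ₜ[k] (x * y) = 1 ⊗ₜ x * 1 ⊗ₜ y := by simp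
      rw [this, map_mul]; exact mul_mem hx hy
  induction w with
  | zero => rw [map_zero]; exact zero_mem _
  | tmul t a =>
    have : t ⊗ₜ[k] a = t • (1 : T) ⊗ₜ[k] a := by rw [TensorProduct.smul_tmul']; simp
    rw [this, map_smul]
    exact P.smul_mem (h a) t
  | add x y hx hy => rw [map_add]; exact add_mem hx hy

variable (R) in
theorem exists_finite_forall_mem_awayRange (u : E ⊗[k] A →ₐ[E] Ω) {a : E ⊗[k] A}
    (hu : ∀ z, ∃ n w, z * u a ^ n = u w) (z : Ω) :
    ∃ C : Set E, C.Finite ∧ ∀ T : Subalgebra R E, C ⊆ T → ∀ d : T ⊗[k] A,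
      T.tensorVal k A d = a → z ∈ (T.tensorRestrict u).awayRange d := by
  obtain ⟨n, w, h⟩ := hu z
  obtain ⟨C, hC, H⟩ := exists_finite_forall_mem_range_tensorVal R A w
  refine ⟨C, hC, fun T hT d hd => ?_⟩
  obtain ⟨w', hw'⟩ := H T hT
  exact ⟨n, w', by
    rw [Subalgebra.tensorRestrict, AlgHom.comp_apply, AlgHom.comp_apply, hd]
    exact h.trans congr(u $hw'.symm)⟩

theorem RingHom.IsStandardOpenImmersion.exists_away {D Ω : Type*} [CommRing D] [CommRing Ω]
    {u : D →+* Ω} (hu : u.IsStandardOpenImmersion) :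
    ∃ a, IsUnit (u a) ∧ (∀ z, ∃ (n : ℕ) (w : D), z * u a ^ n = u w) ∧
      ∀ w, u w = 0 → ∃ n : ℕ, a ^ n * w = 0 := by
  algebraize [u]
  obtain ⟨a, ha⟩ := hu.toAlgebra
  refine ⟨a, IsLocalization.Away.algebraMap_isUnit a, fun z => ?_, fun w hw => ?_⟩
  · obtain ⟨n, w, h⟩ := IsLocalization.Away.surj a z
    exact ⟨n, w, h⟩
  · obtain ⟨⟨_, n, rfl⟩, h⟩ := (IsLocalization.map_eq_zero_iff (Submonoid.powers a) Ω w).mp hw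
    exact ⟨n, h⟩

/-- Flatness embeds `T ⊗ A` in `E ⊗ A`, so torsion relations descend to `T`. -/
theorem isStandardOpenImmersion_codRestrict_tensorRestrict [Module.Flat k A]
    (T : Subalgebra R E) (u : E ⊗[k] A →ₐ[E] Ω) {a : E ⊗[k] A} (ha : IsUnit (u a))
    (hu : ∀ w, u w = 0 → ∃ n : ℕ, a ^ n * w = 0) {d : T ⊗[k] A} (hd : T.tensorVal k A d = a) :
    ((T.tensorRestrict u).codRestrict ((T.tensorRestrict u).awayRange d)
      ((T.tensorRestrict u).apply_mem_awayRange d)).toRingHom.IsStandardOpenImmersion := by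
  refine AlgHom.isStandardOpenImmersion_codRestrict_awayRange _ d ?_ fun w hw => ?_
  · change IsUnit (u (T.tensorVal k A d))
    rwa [hd]
  · obtain ⟨n, hn⟩ := hu _ hw
    refine ⟨n, T.tensorVal_injective A ?_⟩
    rw [map_mul, map_pow, hd, map_zero]
    exact hn

/-- A common localization of `E ⊗ A` and `E ⊗ A'` descends to all subalgebras `T` of `E`
containing a suitable finite set. -/
theorem exists_finite_forall_common_localization [Module.Flat k A] {A' : Type*} [CommRing A']
    [Algebra R A'] [Module.Flat R A'] [Algebra.FiniteType k A] [Algebra.FiniteType R A']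
    (u : E ⊗[k] A →ₐ[E] Ω) (u' : E ⊗[R] A' →ₐ[E] Ω) (hu : u.toRingHom.IsStandardOpenImmersion)
    (hu' : u'.toRingHom.IsStandardOpenImmersion) :
    ∃ C : Set E, C.Finite ∧ ∀ T : Subalgebra R E, C ⊆ T → ∃ P : Subalgebra T Ω,
      (∃ φ : T ⊗[k] A →ₐ[T] P, φ.toRingHom.IsStandardOpenImmersion) ∧
      (∃ φ' : T ⊗[R] A' →ₐ[T] P, φ'.toRingHom.IsStandardOpenImmersion) := by
  obtain ⟨a, ha, hsurj, hker⟩ := hu.exists_away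
  obtain ⟨a', ha', hsurj', hker'⟩ := hu'.exists_away
  obtain ⟨i, hi⟩ := ha.exists_right_inv
  obtain ⟨i', hi'⟩ := ha'.exists_right_inv
  obtain ⟨G, hG⟩ := ‹Algebra.FiniteType k A›
  obtain ⟨G', hG'⟩ := ‹Algebra.FiniteType R A'›
  obtain ⟨C₁, hC₁, h₁⟩ := exists_finite_forall_mem_range_tensorVal R A a
  obtain ⟨C₁', hC₁', h₁'⟩ := exists_finite_forall_mem_range_tensorVal R A' a'
  choose C₂ hC₂ h₂ using exists_finite_forall_mem_awayRange R u hsurj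
  choose C₂' hC₂' h₂' using exists_finite_forall_mem_awayRange R u' hsurj'
  -- These elements suffice to define both denominators over `T`, and to express the inverse of each
  -- denominator and the generators of each algebra as fractions in the other chart. The two rings
  -- of fractions then coincide inside `Ω`.
  refine ⟨C₁ ∪ C₁' ∪ (C₂ i' ∪ C₂' i) ∪
    ((⋃ g ∈ G', C₂ (u' (1 ⊗ₜ g))) ∪ ⋃ g ∈ G, C₂' (u (1 ⊗ₜ g))),
    ((hC₁.union hC₁').union ((hC₂ _).union (hC₂' _))).union
    ((Set.Finite.biUnion G'.finite_toSet fun g _ => hC₂ _).union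
      (Set.Finite.biUnion G.finite_toSet fun g _ => hC₂' _)), fun T hT => ?_⟩
  simp only [Set.union_subset_iff, Set.iUnion_subset_iff] at hT
  obtain ⟨⟨⟨hT₁, hT₁'⟩, hT₂, hT₂'⟩, hT₃, hT₃'⟩ := hT
  obtain ⟨d, hd⟩ := h₁ T hT₁
  obtain ⟨d', hd'⟩ := h₁' T hT₁'
  replace hd : T.tensorVal k A d = a := hd
  replace hd' : T.tensorVal R A' d' = a' := hd'
  have heq : (T.tensorRestrict u').awayRange d' = (T.tensorRestrict u).awayRange d := by
    refine le_antisymm ?_ ?_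
    · refine AlgHom.awayRange_le (T.tensorRestrict_mem u' hG' fun g hg =>
        h₂ _ T (hT₃ g hg) d hd) (h₂ i' T hT₂ d hd) ?_
      change u' (T.tensorVal R A' d') * i' = 1
      rwa [hd']
    · refine AlgHom.awayRange_le (T.tensorRestrict_mem u hG fun g hg =>
        h₂' _ T (hT₃' g hg) d' hd') (h₂' i T hT₂' d' hd') ?_
      change u (T.tensorVal k A d) * i = 1
      rwa [hd]
  refine ⟨(T.tensorRestrict u).awayRange d,
    ⟨_, isStandardOpenImmersion_codRestrict_tensorRestrict T u ha hker hd⟩, ?_⟩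
  rw [← heq]
  exact ⟨_, isStandardOpenImmersion_codRestrict_tensorRestrict T u' ha' hker' hd'⟩

end Tensor

/-- Finitely many elements algebraic over a domain `R` are contained in an algebra finite over a
localization of `R` at one element. -/
theorem exists_ne_zero_forall_isIntegral {R E : Type*} [CommRing R] [IsDomain R] [CommRing E]
    [Algebra R E] [Algebra.IsAlgebraic R E] {C : Set E} (hC : C.Finite) :
    ∃ r : R, r ≠ 0 ∧ ∀ (L : Type*) [CommRing L] [Algebra R L] [Algebra L E] [IsScalarTower R L E],
      IsUnit (algebraMap R L r) → ∀ c ∈ C, IsIntegral L c := by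
  have h : ∀ c : E, ∃ y : R, y ≠ 0 ∧ IsIntegral R (y • c) := fun c =>
    (Algebra.IsAlgebraic.isAlgebraic (R := R) c).exists_integral_multiple
  choose y hy hyc using h
  refine ⟨∏ c ∈ hC.toFinset, y c, Finset.prod_ne_zero_iff.mpr fun c _ => hy c, ?_⟩
  intro L _ _ _ _ hr c hc
  have hyu : IsUnit (algebraMap R L (y c)) :=
    isUnit_of_dvd_unit (map_dvd _ (Finset.dvd_prod_of_mem y (hC.mem_toFinset.mpr hc))) hr
  obtain ⟨i, hi⟩ := hyu.exists_left_inv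
  have h1 : IsIntegral L (y c • c) := (hyc c).tower_top
  have h2 := h1.smul i
  rwa [← algebraMap_smul L (y c) c, smul_smul, hi, one_smul] at h2

/-! ### Common basic opens of birational affine schemes -/

/-- Open immersions with the same image differ by an isomorphism, here between `Ω` and `Q` localized
at `q`. -/
theorem isStandardOpenImmersion_of_opensRange_eq_basicOpen {Q Ω : CommRingCat.{u}} (φ : Q ⟶ Ω)
    [IsOpenImmersion (Spec.map φ)] (q : Q)
    (h : Set.range (Spec.map φ) = (PrimeSpectrum.basicOpen q : Set (PrimeSpectrum Q))) :
    φ.hom.IsStandardOpenImmersion := by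
  let ℓ : Q ⟶ .of (Localization.Away q) := CommRingCat.ofHom (algebraMap Q (Localization.Away q))
  have hℓ : Set.range (Spec.map ℓ) = (PrimeSpectrum.basicOpen q : Set (PrimeSpectrum Q)) :=
    congrArg SetLike.coe (Scheme.Hom.opensRange_localizationAway q)
  have : IsOpenImmersion (Spec.map ℓ) := Scheme.isOpenImmersion_SpecMap_localizationAway q
  let e := IsOpenImmersion.isoOfRangeEq (Spec.map ℓ) (Spec.map φ) (hℓ.trans h.symm)
  obtain ⟨ψ, hψ⟩ := Spec.map_surjective e.inv
  obtain ⟨χ, hχ⟩ := Spec.map_surjective e.hom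
  have hψ' : IsIso ψ := ⟨χ, Spec.map_injective (by rw [Spec.map_comp, hψ, hχ]; simp),
    Spec.map_injective (by rw [Spec.map_comp, hψ, hχ]; simp)⟩
  have hφ : φ = ℓ ≫ ψ := by
    apply Spec.map_injective
    rw [Spec.map_comp, hψ]
    exact (IsOpenImmersion.isoOfRangeEq_inv_fac _ _ _).symm
  rw [hφ]
  refine (RingHom.IsStandardOpenImmersion.algebraMap q).comp (.of_bijective ?_)
  exact (ConcreteCategory.isIso_iff_bijective ψ).mp hψ'

theorem isOpenImmersion_SpecMap_of_isStandardOpenImmersion {Q Ω : CommRingCat.{u}} (φ : Q ⟶ Ω)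
    (h : φ.hom.IsStandardOpenImmersion) : IsOpenImmersion (Spec.map φ) := by
  algebraize [φ.hom]
  obtain ⟨q, hq⟩ := h.toAlgebra
  exact IsOpenImmersion.of_isLocalization q

theorem exists_algHom_away_of_partialIso {E P Q : Type u} [CommRing E] [CommRing P]
    [CommRing Q] [Algebra E P] [Algebra E Q] [Nontrivial P]
    (e : Scheme.PartialIso (Spec (.of P)) (Spec (.of Q)))
    (he : e.IsOver (Spec.map (CommRingCat.ofHom (algebraMap E P)))
      (Spec.map (CommRingCat.ofHom (algebraMap E Q)))) :
    ∃ (p : P) (ψ : Q →ₐ[E] Localization.Away p), Nontrivial (Localization.Away p) ∧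
      IsOpenImmersion (Spec.map (CommRingCat.ofHom ψ.toRingHom)) := by
  have : Nonempty (Spec (.of P)) := inferInstanceAs (Nonempty (PrimeSpectrum P))
  obtain ⟨z, hz⟩ := e.dense_source.nonempty
  obtain ⟨_, ⟨_, ⟨p, rfl⟩, rfl⟩, hzp, hp⟩ :=
    (PrimeSpectrum.isBasis_basic_opens (R := P)).exists_subset_of_mem_open hz e.source.isOpen
  let ℓ : CommRingCat.of P ⟶ .of (Localization.Away p) :=
    CommRingCat.ofHom (algebraMap P (Localization.Away p))
  have : IsOpenImmersion (Spec.map ℓ) :=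
    Scheme.isOpenImmersion_SpecMap_localizationAway (R := .of P) p
  have hℓ : Set.range (Spec.map ℓ) = (PrimeSpectrum.basicOpen p : Set (PrimeSpectrum P)) :=
    congrArg SetLike.coe (Scheme.Hom.opensRange_localizationAway (R := .of P) p)
  have hℓe : Set.range (Spec.map ℓ) ⊆ Set.range e.source.ι := by
    rw [hℓ, Scheme.Opens.range_ι]
    exact hp
  let j₀ := IsOpenImmersion.lift e.source.ι (Spec.map ℓ) hℓe
  have hj₀ : j₀ ≫ e.source.ι = Spec.map ℓ := IsOpenImmersion.lift_fac _ _ _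
  have : IsOpenImmersion (j₀ ≫ e.source.ι) := by rw [hj₀]; infer_instance
  have : IsOpenImmersion j₀ := .of_comp j₀ e.source.ι
  obtain ⟨ψ, hψ⟩ := Spec.map_surjective (j₀ ≫ e.iso.hom ≫ e.target.ι)
  have hE : CommRingCat.ofHom (algebraMap E Q) ≫ ψ =
      CommRingCat.ofHom (algebraMap E (Localization.Away p)) := by
    apply Spec.map_injective
    rw [Spec.map_comp, hψ, Category.assoc, Category.assoc, he, reassoc_of% hj₀, ← Spec.map_comp]
    exact congrArg Spec.map (CommRingCat.hom_ext (IsScalarTower.algebraMap_eq E P _).symm)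
  refine ⟨p, { toRingHom := ψ.hom, commutes' := fun a => DFunLike.congr_fun congr(($hE).hom) a },
    ?_, ?_⟩
  · obtain ⟨y, -⟩ : z ∈ Set.range (Spec.map ℓ) := by rw [hℓ]; exact hzp
    exact y.nontrivial
  · change IsOpenImmersion (Spec.map ψ)
    rw [hψ]; infer_instance

/-- A basic open `D(q)` inside the image of `Spec P` has preimage `D(ψ q)`, so shrinking to it gives
an open set that is basic on both sides. -/
theorem exists_algHom_of_isOpenImmersion {E P Q : Type u} [CommRing E] [CommRing P]
    [CommRing Q] [Algebra E P] [Algebra E Q] [Nontrivial P] (ψ : Q →ₐ[E] P)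
    [IsOpenImmersion (Spec.map (CommRingCat.ofHom ψ.toRingHom))] :
    ∃ (p : P) (v : Q →ₐ[E] Localization.Away p), Nontrivial (Localization.Away p) ∧
      v.toRingHom.IsStandardOpenImmersion := by
  let ψ' : CommRingCat.of Q ⟶ .of P := CommRingCat.ofHom ψ.toRingHom
  have : IsOpenImmersion (Spec.map ψ') := ‹_›
  obtain ⟨z⟩ : Nonempty (Spec (.of P)) := inferInstanceAs (Nonempty (PrimeSpectrum P))
  obtain ⟨_, ⟨_, ⟨q, rfl⟩, rfl⟩, hzq, hq⟩ :=
    (PrimeSpectrum.isBasis_basic_opens (R := Q)).exists_subset_of_mem_open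
      (Set.mem_range_self z) (Spec.map ψ').isOpenEmbedding.isOpen_range
  let m : CommRingCat.of P ⟶ .of (Localization.Away (ψ q)) :=
    CommRingCat.ofHom (algebraMap P (Localization.Away (ψ q)))
  have : IsOpenImmersion (Spec.map m) :=
    Scheme.isOpenImmersion_SpecMap_localizationAway (R := .of P) (ψ q)
  have hm : Set.range (Spec.map m) =
      (PrimeSpectrum.basicOpen (ψ q) : Set (PrimeSpectrum P)) :=
    congrArg SetLike.coe (Scheme.Hom.opensRange_localizationAway (R := .of P) (ψ q))
  have : IsOpenImmersion (Spec.map (ψ' ≫ m)) := by rw [Spec.map_comp]; infer_instance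
  have hrange : Set.range (Spec.map (ψ' ≫ m)) =
      (PrimeSpectrum.basicOpen q : Set (PrimeSpectrum Q)) := by
    have h : (PrimeSpectrum.basicOpen (ψ q) : Set (PrimeSpectrum P)) =
      Spec.map ψ' ⁻¹' (PrimeSpectrum.basicOpen q : Set (PrimeSpectrum Q)) := rfl
    rw [Spec.map_comp, Scheme.Hom.comp_base, TopCat.coe_comp, Set.range_comp, hm, h]
    exact Set.image_preimage_eq_of_subset hq
  refine ⟨ψ q, (IsScalarTower.toAlgHom E P _).comp ψ, ?_,
    isStandardOpenImmersion_of_opensRange_eq_basicOpen (ψ' ≫ m) q hrange⟩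
  obtain ⟨y, -⟩ : z ∈ Set.range (Spec.map m) := by rw [hm]; exact hzq
  exact y.nontrivial

/-- Birational affine schemes have a common basic open subscheme. -/
theorem AlgebraicGeometry.Scheme.BirationalOver.exists_common_localization {E P Q : Type u}
    [CommRing E] [CommRing P] [CommRing Q] [Algebra E P] [Algebra E Q] [Nontrivial P]
    (h : Scheme.BirationalOver (Spec.map (CommRingCat.ofHom (algebraMap E P)))
      (Spec.map (CommRingCat.ofHom (algebraMap E Q)))) :
    ∃ (Ω : Type u) (_ : CommRing Ω) (_ : Algebra E Ω) (u : P →ₐ[E] Ω) (v : Q →ₐ[E] Ω),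
      Nontrivial Ω ∧ u.toRingHom.IsStandardOpenImmersion ∧
        v.toRingHom.IsStandardOpenImmersion := by
  obtain ⟨e, he⟩ := h
  obtain ⟨p, ψ, hp, hψ⟩ := exists_algHom_away_of_partialIso e he
  obtain ⟨p', v, hp', hv⟩ := exists_algHom_of_isOpenImmersion ψ
  exact ⟨Localization.Away p', inferInstance, inferInstance,
    (IsScalarTower.toAlgHom E (Localization.Away p) _).comp (IsScalarTower.toAlgHom E P _), v, hp',
    (RingHom.IsStandardOpenImmersion.algebraMap p).comp
      (RingHom.IsStandardOpenImmersion.algebraMap p'), hv⟩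

/-! ### Dense charts in flat families -/

/-- An open subset of a scheme flat over an irreducible base is dense if it meets the geometric
generic fibre, and the latter is irreducible. -/
theorem isDominant_of_flat_of_irreducibleSpace {V Z Z' S S' N : Scheme.{u}} [IrreducibleSpace S]
    (j : V ⟶ Z) [IsOpenImmersion j] {h : Z' ⟶ Z} {g' : Z' ⟶ S'} {g : Z ⟶ S} {q : S' ⟶ S}
    (H : IsPullback h g' g q) [Flat g] [IrreducibleSpace Z'] (hq : genericPoint S ∈ Set.range q)
    [Nonempty N] (n : N ⟶ V) (m : N ⟶ S') (hnm : n ≫ j ≫ g = m ≫ q) : IsDominant j := by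
  refine ⟨dense_iff_inter_open.mpr fun O hO ⟨z, hz⟩ => ?_⟩
  -- Generalizations lift along flat maps, so `O` contains a point over the generic point of `S`,
  -- and thus meets the image of `Z'`.
  obtain ⟨z', hz', hgz'⟩ := (Flat.generalizingMap g) (genericPoint_specializes (g z))
  have hz'O : z' ∈ O := hz'.mem_open hO hz
  obtain ⟨s, hs⟩ := hq
  obtain ⟨y, hy, -⟩ := Scheme.Pullback.exists_preimage_pullback z' s (hgz'.trans hs.symm)
  have hy' : h (H.isoPullback.inv y) = z' := by
    rw [← Scheme.Hom.comp_apply, H.isoPullback_inv_fst, hy]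
  let l : N ⟶ Z' := H.lift (n ≫ j) m (by simpa using hnm)
  have hl : h (l (Classical.arbitrary N)) = j (n (Classical.arbitrary N)) := by
    rw [← Scheme.Hom.comp_apply, H.lift_fst, Scheme.Hom.comp_apply]
  obtain ⟨x, hx, hx'⟩ := nonempty_preirreducible_inter (hO.preimage h.continuous)
    (j.isOpenEmbedding.isOpen_range.preimage h.continuous)
    ⟨_, show h (H.isoPullback.inv y) ∈ O from hy' ▸ hz'O⟩
    ⟨l (Classical.arbitrary N), by rw [Set.mem_preimage, hl]; exact Set.mem_range_self _⟩
  exact ⟨h x, hx, hx'⟩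

section Chart

variable {R A : Type u} [CommRing R] [CommRing A] [Algebra R A] {B X : Scheme.{u}} (f : X ⟶ B)
  (ι : Spec (.of R) ⟶ B) [Mono ι] (w : Spec (.of A) ⟶ X)
  (hw : w ≫ f = Spec.map (CommRingCat.ofHom (algebraMap R A)) ≫ ι)

include hw in
/-- An affine chart `Spec A` of `X`, lying over the affine chart `Spec R` of `B`, induces a chart
`Spec (E ⊗ A)` of the base change of `X` to `Spec E`. -/
theorem exists_isPullback_tensor (E : Type u) [CommRing E] [Algebra R E]
    {x : Spec (.of E) ⟶ B} (hx : x = Spec.map (CommRingCat.ofHom (algebraMap R E)) ≫ ι) :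
    ∃ ω : Spec (.of (E ⊗[R] A)) ⟶ pullback f x,
      ω ≫ pullback.snd f x = Spec.map (CommRingCat.ofHom (algebraMap E (E ⊗[R] A))) ∧
      IsPullback ω (Spec.map (CommRingCat.ofHom
        (Algebra.TensorProduct.includeRight : A →ₐ[R] E ⊗[R] A).toRingHom))
        (pullback.fst f x) w := by
  -- As `ι` is a monomorphism, fibre products over `Spec R` and over `B` agree.
  have h₁ := (isPullback_SpecMap_of_isPushout _ _ _ _
    (CommRingCat.isPushout_tensorProduct R E A)).paste_horiz
      (t := IsPullback.of_horiz_isIso_mono (fst := 𝟙 (Spec (.of E))) (g := ι)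
        (snd := Spec.map (CommRingCat.ofHom (algebraMap R E))) (f := x) ⟨by rw [hx]; simp⟩)
  rw [Category.comp_id, ← hw] at h₁
  exact ⟨_, (IsPullback.of_hasPullback f x).flip.lift_fst _ _ _,
    h₁.of_right' (IsPullback.of_hasPullback f x).flip⟩

include hw in
theorem birationalOver_snd_of_isStandardOpenImmersion [IsOpenImmersion w] [Flat f] {E Ω T : Type u}
    [Field E] [Algebra R E] {x : Spec (.of E) ⟶ B}
    (hx : x = Spec.map (CommRingCat.ofHom (algebraMap R E)) ≫ ι) [IrreducibleSpace ↥(pullback f x)]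
    [CommRing Ω] [Nontrivial Ω] [Algebra E Ω] [CommRing T] [IsDomain T] [Algebra R T] [Algebra T E]
    [IsScalarTower R T E] [FaithfulSMul T E] [Algebra T Ω] [IsScalarTower T E Ω]
    {y : Spec (.of T) ⟶ B}
    (hy : y = Spec.map (CommRingCat.ofHom (algebraMap R T)) ≫ ι) (P : Subalgebra T Ω)
    (φ : T ⊗[R] A →ₐ[T] P) (hφ : φ.toRingHom.IsStandardOpenImmersion) :
    Scheme.BirationalOver (Spec.map (CommRingCat.ofHom (algebraMap T P))) (pullback.snd f y) := by
  obtain ⟨ω, hω, H⟩ := exists_isPullback_tensor f ι w hw T hy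
  have : IsOpenImmersion ω := MorphismProperty.of_isPullback H.flip ‹_›
  let φ' : CommRingCat.of (T ⊗[R] A) ⟶ .of P := CommRingCat.ofHom φ.toRingHom
  have : IsOpenImmersion (Spec.map φ') := isOpenImmersion_SpecMap_of_isStandardOpenImmersion φ' hφ
  let q : Spec (.of E) ⟶ Spec (.of T) := Spec.map (CommRingCat.ofHom (algebraMap T E))
  have hqy : x = q ≫ y := by
    rw [hy, hx, ← Spec.map_comp_assoc, ← CommRingCat.ofHom_comp, ← IsScalarTower.algebraMap_eq]
  subst hqy
  have H' := (IsPullback.of_hasPullback f (q ≫ y)).of_right' (IsPullback.of_hasPullback f y)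
  have hj : (Spec.map φ' ≫ ω) ≫ pullback.snd f y =
      Spec.map (CommRingCat.ofHom (algebraMap T P)) := by
    rw [Category.assoc, hω, ← Spec.map_comp]
    exact congrArg Spec.map (CommRingCat.hom_ext φ.comp_algebraMap)
  have hq : genericPoint (Spec (.of T)) ∈ Set.range q := by
    refine ⟨(⊥ : PrimeSpectrum E), ?_⟩
    rw [genericPoint_eq_bot_of_affine]
    refine PrimeSpectrum.ext ?_
    exact (RingHom.injective_iff_ker_eq_bot _).mp (FaithfulSMul.algebraMap_injective T E)
  have : Nonempty (Spec (.of Ω)) := inferInstanceAs (Nonempty (PrimeSpectrum Ω))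
  -- The nonempty scheme `Spec Ω` witnesses that the chart meets the geometric generic fibre.
  have := isDominant_of_flat_of_irreducibleSpace (Spec.map φ' ≫ ω) H' hq
    (Spec.map (CommRingCat.ofHom P.val.toRingHom)) (Spec.map (CommRingCat.ofHom (algebraMap E Ω)))
    (by
      rw [hj, ← Spec.map_comp, ← Spec.map_comp, ← CommRingCat.ofHom_comp, ← CommRingCat.ofHom_comp,
        ← IsScalarTower.algebraMap_eq]
      rfl)
  exact (Spec.map φ' ≫ ω).birationalOver _ _ hj

end Chart

/-- The chart is taken around the image of `z`, so its base change contains a point and `E ⊗ A` is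
nonzero. -/
theorem exists_chart_of_mem_pullback {R E : Type u} [CommRing R] [CommRing E] [Algebra R E]
    {B X : Scheme.{u}} (f : X ⟶ B) [LocallyOfFiniteType f] [Flat f] (ι : Spec (.of R) ⟶ B)
    [IsOpenImmersion ι] {x : Spec (.of E) ⟶ B}
    (hx : x = Spec.map (CommRingCat.ofHom (algebraMap R E)) ≫ ι) (z : ↥(pullback f x)) :
    ∃ (A : Type u) (_ : CommRing A) (_ : Algebra R A) (w : Spec (.of A) ⟶ X),
      IsOpenImmersion w ∧ w ≫ f = Spec.map (CommRingCat.ofHom (algebraMap R A)) ≫ ι ∧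
      Algebra.FiniteType R A ∧ Module.Flat R A ∧ Nontrivial (E ⊗[R] A) := by
  subst hx
  have hz : pullback.fst f _ z ∈ f ⁻¹ᵁ ι.opensRange := by
    change f (pullback.fst f _ z) ∈ Set.range ι
    rw [← Scheme.Hom.comp_apply, pullback.condition, Scheme.Hom.comp_apply,
      Scheme.Hom.comp_apply]
    exact Set.mem_range_self _
  obtain ⟨_, ⟨V, hV, rfl⟩, hzV, hVU⟩ :=
    X.isBasis_affineOpens.exists_subset_of_mem_open hz (f ⁻¹ᵁ ι.opensRange).isOpen
  replace hV : IsAffineOpen V := hV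
  have := hV.isOpenImmersion_fromSpec
  have hrange : Set.range (hV.fromSpec ≫ f) ⊆ Set.range ι := by
    rw [Scheme.Hom.comp_base, TopCat.coe_comp, Set.range_comp, hV.range_fromSpec]
    exact Set.image_subset_iff.mpr hVU
  obtain ⟨φ, hφ⟩ := Spec.map_surjective (IsOpenImmersion.lift ι (hV.fromSpec ≫ f) hrange)
  have hφι : Spec.map φ ≫ ι = hV.fromSpec ≫ f := by rw [hφ, IsOpenImmersion.lift_fac]
  have H : IsPullback (𝟙 _) (Spec.map φ) (hV.fromSpec ≫ f) ι :=
    IsPullback.of_horiz_isIso_mono ⟨by simp [hφι]⟩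
  have hflat : Flat (Spec.map φ) := MorphismProperty.of_isPullback (P := @Flat) H inferInstance
  have hft : LocallyOfFiniteType (Spec.map φ) :=
    MorphismProperty.of_isPullback (P := @LocallyOfFiniteType) H inferInstance
  rw [HasRingHomProperty.Spec_iff (P := @Flat)] at hflat
  rw [HasRingHomProperty.Spec_iff (P := @LocallyOfFiniteType)] at hft
  algebraize [φ.hom]
  have hw : hV.fromSpec ≫ f = Spec.map (CommRingCat.ofHom (algebraMap R Γ(X, V))) ≫ ι := hφι.symm
  refine ⟨Γ(X, V), inferInstance, inferInstance, hV.fromSpec, inferInstance, hw, ‹_›, ‹_›, ?_⟩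
  obtain ⟨ω, -, H⟩ := exists_isPullback_tensor f ι hV.fromSpec hw E rfl
  have hz' : pullback.fst f _ z ∈ Set.range hV.fromSpec := by rw [hV.range_fromSpec]; exact hzV
  obtain ⟨v, hv⟩ := hz'
  obtain ⟨t, -⟩ := Scheme.Pullback.exists_preimage_pullback z v hv.symm
  exact (H.isoPullback.inv t).nontrivial

/-- A flat morphism of finite type has an affine chart over an affine chart of the base which is
dense in the given irreducible base change. -/
theorem exists_chart_birationalOver_pullback_snd {R E : Type u} [CommRing R] [CommRing E]
    [Algebra R E] {B X : Scheme.{u}} (f : X ⟶ B) [LocallyOfFiniteType f] [Flat f]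
    (ι : Spec (.of R) ⟶ B) [IsOpenImmersion ι] {x : Spec (.of E) ⟶ B}
    (hx : x = Spec.map (CommRingCat.ofHom (algebraMap R E)) ≫ ι)
    [IrreducibleSpace ↥(pullback f x)] :
    ∃ (A : Type u) (_ : CommRing A) (_ : Algebra R A) (w : Spec (.of A) ⟶ X),
      IsOpenImmersion w ∧ w ≫ f = Spec.map (CommRingCat.ofHom (algebraMap R A)) ≫ ι ∧
      Algebra.FiniteType R A ∧ Module.Flat R A ∧ Nontrivial (E ⊗[R] A) ∧
      Scheme.BirationalOver (Spec.map (CommRingCat.ofHom (algebraMap E (E ⊗[R] A))))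
        (pullback.snd f x) := by
  obtain ⟨A, _, _, w, _, hw, hA, hA', hEA⟩ :=
    exists_chart_of_mem_pullback f ι hx (Classical.arbitrary _)
  obtain ⟨ω, hω, H⟩ := exists_isPullback_tensor f ι w hw E hx
  have : IsOpenImmersion ω := MorphismProperty.of_isPullback H.flip ‹_›
  have : Nonempty (Spec (.of (E ⊗[R] A))) := inferInstanceAs (Nonempty (PrimeSpectrum (E ⊗[R] A)))
  have : IsDominant ω := ⟨ω.isOpenEmbedding.isOpen_range.dense (Set.range_nonempty ω)⟩
  exact ⟨A, _, _, w, ‹_›, hw, hA, hA', hEA, ω.birationalOver _ _ hω⟩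

/-! ### Construction of the finite cover -/

/-- A flat family which is birationally trivial over an algebraic extension `E` of the coordinate
ring `R` of an affine chart of the base becomes birationally trivial after a finite cover of an open
subset. -/
theorem birationallyTrivialOnFiniteCover_of_birationalOver {k R E : Type u} [Field k] [CommRing R]
    [IsDomain R] [Algebra k R] [Field E] [Algebra R E] [Algebra k E] [IsScalarTower k R E]
    [FaithfulSMul R E] [Algebra.IsAlgebraic R E] {B X X₀ : Scheme.{u}} [IrreducibleSpace B]
    (sB : B ⟶ Spec (.of k)) (ι : Spec (.of R) ⟶ B) [IsOpenImmersion ι]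
    (hι : ι ≫ sB = Spec.map (CommRingCat.ofHom (algebraMap k R)))
    (f : X ⟶ B) [LocallyOfFiniteType f] [Flat f] (s₀ : X₀ ⟶ Spec (.of k)) [LocallyOfFiniteType s₀]
    [Flat s₀] {x : Spec (.of E) ⟶ B}
    (hx : x = Spec.map (CommRingCat.ofHom (algebraMap R E)) ≫ ι) [IrreducibleSpace ↥(pullback f x)]
    (h : Scheme.BirationalOver (pullback.snd f x)
      (pullback.snd s₀ (Spec.map (CommRingCat.ofHom (algebraMap k E))))) :
    BirationallyTrivialOnFiniteCover sB f s₀ := by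
  have := h.irreducibleSpace
  obtain ⟨A, _, _, w, _, hw, _, _, _, hA⟩ := exists_chart_birationalOver_pullback_snd f ι hx
  -- `X₀` is treated as a flat family over `Spec k`, with the identity as chart of the base.
  have hx₀ : Spec.map (CommRingCat.ofHom (algebraMap k E)) =
    Spec.map (CommRingCat.ofHom (algebraMap k E)) ≫ 𝟙 _ := (Category.comp_id _).symm
  obtain ⟨A₀, _, _, w₀, _, hw₀, _, _, _, hA₀⟩ :=
    exists_chart_birationalOver_pullback_snd s₀ (𝟙 _) hx₀
  obtain ⟨Ω, _, _, u, u', _, hu, hu'⟩ :=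
    ((hA₀.trans h.symm).trans hA.symm).exists_common_localization
  obtain ⟨C, hC, hCT⟩ := exists_finite_forall_common_localization u u' hu hu'
  obtain ⟨r, hr, hrL⟩ := exists_ne_zero_forall_isIntegral (R := R) hC
  let L := Localization.Away r
  let : Algebra L E := (IsLocalization.Away.lift (S := L) r (g := algebraMap R E)
    (by simpa using hr)).toAlgebra
  have : IsScalarTower R L E := .of_algebraMap_eq fun a => (IsLocalization.Away.lift_eq r _ a).symm
  -- Adjoining over `L` makes the algebra finite over `L`; regarded over `R`, it is a subalgebra to
  -- which the descent applies.
  let TL : Subalgebra L E := Algebra.adjoin L C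
  let T : Subalgebra R E := TL.restrictScalars R
  obtain ⟨P, ⟨φ, hφ⟩, φ', hφ'⟩ := hCT T Algebra.subset_adjoin
  have hint : Algebra.IsIntegral L TL :=
    Algebra.IsIntegral.adjoin (hrL L (IsLocalization.Away.algebraMap_isUnit r))
  have hfin : Module.Finite L TL :=
    Module.Finite.iff_fg.mpr (fg_adjoin_of_finite hC
      (hrL L (IsLocalization.Away.algebraMap_isUnit r)))
  let l : Spec (.of L) ⟶ Spec (.of R) := Spec.map (CommRingCat.ofHom (algebraMap R L))
  have : IsOpenImmersion l := Scheme.isOpenImmersion_SpecMap_localizationAway (R := .of R) r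
  let q : Spec (.of T) ⟶ Spec (.of L) := Spec.map (CommRingCat.ofHom (algebraMap L TL))
  let p : Spec (.of T) ⟶ (l ≫ ι).opensRange := q ≫ (l ≫ ι).isoOpensRange.hom
  have hp : p ≫ (l ≫ ι).opensRange.ι = Spec.map (CommRingCat.ofHom (algebraMap R T)) ≫ ι := by
    rw [Category.assoc, Scheme.Hom.isoOpensRange_hom_ι, ← Category.assoc, ← Spec.map_comp]
    exact congrArg (fun a => Spec.map a ≫ ι) (CommRingCat.hom_ext (RingHom.ext fun a =>
      Subtype.ext (IsScalarTower.algebraMap_apply R L E a).symm))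
  have hk : p ≫ (l ≫ ι).opensRange.ι ≫ sB =
      Spec.map (CommRingCat.ofHom (algebraMap k T)) ≫ 𝟙 _ := by
    rw [reassoc_of% hp, hι, ← Spec.map_comp, ← CommRingCat.ofHom_comp,
      ← IsScalarTower.algebraMap_eq, Category.comp_id]
  have hRL : Function.Injective (algebraMap R L) :=
    IsLocalization.injective L (Submonoid.powers_le.mpr (mem_nonZeroDivisors_of_ne_zero hr))
  have hLE : Function.Injective (algebraMap L E) :=
    (IsLocalization.lift_injective_iff _).mpr fun a b =>
      hRL.eq_iff.trans (FaithfulSMul.algebraMap_injective R E).eq_iff.symm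
  have : Nontrivial L := hRL.nontrivial
  have : Nonempty (Spec (.of L)) := inferInstanceAs (Nonempty (PrimeSpectrum L))
  have : FaithfulSMul L TL := (faithfulSMul_iff_algebraMap_injective L TL).mpr
    (.of_comp (f := algebraMap TL E) hLE)
  have : IsFinite q := IsFinite.SpecMap_iff _ |>.mpr (RingHom.finite_algebraMap.mpr hfin)
  have : Surjective q := ⟨Algebra.IsIntegral.comap_surjective L TL⟩
  refine ⟨(l ≫ ι).opensRange, (l ≫ ι).opensRange.isOpen.dense (Set.range_nonempty (l ≫ ι)),
    Spec (.of T), p, inferInstance, inferInstance, inferInstance, ?_⟩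
  have h₁ := birationalOver_snd_of_isStandardOpenImmersion f ι w hw hx hp P φ' hφ'
  have h₂ := birationalOver_snd_of_isStandardOpenImmersion s₀ (𝟙 _) w₀ hw₀ hx₀ hk P φ hφ
  exact h₁.symm.trans (h₂.trans (.of_iso (pullbackSymmetry _ _) (by simp)))

end

/-! ### Finiteness and separatedness of projective space -/

section ProjSpace

variable (k : Type u) [Field k] (t : ℕ)

theorem algebraMap_homogeneousSubmodule_zero_surjective (σ : Type*) :
    Function.Surjective (algebraMap k (MvPolynomial.homogeneousSubmodule σ k 0)) := by
  rintro ⟨p, hp⟩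
  rw [MvPolynomial.homogeneousSubmodule_zero, Submodule.mem_one] at hp
  obtain ⟨a, ha⟩ := hp
  exact ⟨a, Subtype.ext ha⟩

instance : Algebra.FiniteType (MvPolynomial.homogeneousSubmodule (Fin (t + 1)) k 0)
    (MvPolynomial (Fin (t + 1)) k) :=
  have : IsScalarTower k (MvPolynomial.homogeneousSubmodule (Fin (t + 1)) k 0)
    (MvPolynomial (Fin (t + 1)) k) := ⟨fun a x y => smul_mul_assoc a x.1 y⟩
  .of_restrictScalars_finiteType k _ _

instance : IsSeparated (projSpaceToSpec k t) :=
  have := Proj.isSeparated (MvPolynomial.homogeneousSubmodule (Fin (t + 1)) k)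
  inferInstanceAs (IsSeparated
    (Proj.toSpecZero (MvPolynomial.homogeneousSubmodule (Fin (t + 1)) k) ≫
    Spec.map (CommRingCat.ofHom
      (algebraMap k (MvPolynomial.homogeneousSubmodule (Fin (t + 1)) k 0)))))

instance : LocallyOfFiniteType (projSpaceToSpec k t) :=
  have : LocallyOfFiniteType (Spec.map (CommRingCat.ofHom
      (algebraMap k (MvPolynomial.homogeneousSubmodule (Fin (t + 1)) k 0)))) := by
    rw [HasRingHomProperty.Spec_iff (P := @LocallyOfFiniteType)]
    exact RingHom.FiniteType.of_surjective _ (algebraMap_homogeneousSubmodule_zero_surjective k _)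
  inferInstanceAs (LocallyOfFiniteType
    (Proj.toSpecZero (MvPolynomial.homogeneousSubmodule (Fin (t + 1)) k) ≫
      Spec.map (CommRingCat.ofHom
      (algebraMap k (MvPolynomial.homogeneousSubmodule (Fin (t + 1)) k 0)))))

instance : QuasiCompact (projSpaceToSpec k t) :=
  inferInstanceAs (QuasiCompact
    (Proj.toSpecZero (MvPolynomial.homogeneousSubmodule (Fin (t + 1)) k) ≫
      Spec.map (CommRingCat.ofHom
      (algebraMap k (MvPolynomial.homogeneousSubmodule (Fin (t + 1)) k 0)))))

end ProjSpace

/-! ### The geometric generic point in an affine chart, and the conclusion -/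

/-- The function field is the fraction field of the coordinate ring of any nonempty affine open
subset, so its algebraic closure is algebraic over that ring. -/
theorem exists_affine_chart_geomGenericPoint {k : Type u} [Field k] {B : Scheme.{u}} [IsIntegral B]
    (sB : B ⟶ Spec (.of k)) [LocallyOfFiniteType sB] :
    ∃ (R : Type u) (_ : CommRing R) (_ : IsDomain R) (_ : Algebra k R)
      (_ : Algebra R (AlgebraicClosure B.functionField))
      (_ : Algebra k (AlgebraicClosure B.functionField))
      (_ : IsScalarTower k R (AlgebraicClosure B.functionField)) (ι : Spec (.of R) ⟶ B),
      Algebra.FiniteType k R ∧ FaithfulSMul R (AlgebraicClosure B.functionField) ∧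
      Algebra.IsAlgebraic R (AlgebraicClosure B.functionField) ∧ IsOpenImmersion ι ∧
      ι ≫ sB = Spec.map (CommRingCat.ofHom (algebraMap k R)) ∧
      geomGenericPoint B = Spec.map (CommRingCat.ofHom
        (algebraMap R (AlgebraicClosure B.functionField))) ≫ ι := by
  obtain ⟨U, hU, hηU⟩ := exists_isAffineOpen_mem_and_subset (X := B) (U := ⊤)
    (x := genericPoint B) trivial
  have : Nonempty U := ⟨⟨_, hηU.1⟩⟩
  obtain ⟨φ, hφ⟩ := Spec.map_surjective (hU.fromSpec ≫ sB)
  have hft : LocallyOfFiniteType (Spec.map φ) := by rw [hφ]; infer_instance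
  rw [HasRingHomProperty.Spec_iff (P := @LocallyOfFiniteType)] at hft
  let : Algebra k Γ(B, U) := φ.hom.toAlgebra
  have : Algebra.FiniteType k Γ(B, U) := hft
  let i : Algebra Γ(B, U) (AlgebraicClosure B.functionField) := inferInstance
  have : IsScalarTower Γ(B, U) B.functionField (AlgebraicClosure B.functionField) :=
    inferInstance
  let : Algebra k (AlgebraicClosure B.functionField) :=
    ((algebraMap Γ(B, U) (AlgebraicClosure B.functionField)).comp φ.hom).toAlgebra
  have : IsFractionRing Γ(B, U) B.functionField :=
    functionField_isFractionRing_of_isAffineOpen B U hU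
  have : FaithfulSMul Γ(B, U) B.functionField := inferInstance
  have : Algebra.IsAlgebraic Γ(B, U) B.functionField :=
    IsLocalization.isAlgebraic _ (nonZeroDivisors _)
  refine ⟨Γ(B, U), inferInstance, inferInstance, inferInstance, i, inferInstance,
    .of_algebraMap_eq' rfl, hU.fromSpec, ‹_›, .trans _ B.functionField _,
    .trans _ B.functionField _, inferInstance, hφ.symm, ?_⟩
  rw [geomGenericPoint, ← hU.fromSpecStalk_eq_fromSpecStalk hηU.1, IsAffineOpen.fromSpecStalk,
    ← Spec.map_comp_assoc]
  rfl

theorem theorem1p1 {k : Type u} [Field k] [IsAlgClosed k] (hk : HasInfiniteTrdeg k)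
    -- the irreducible base variety
    {B : Scheme.{u}} [IsIntegral B] (sB : B ⟶ Spec (.of k)) (hB : IsIrreducibleVariety sB)
    -- the projective flat family `X ⊆ B × ℙ^t ⟶ B`
    (t : ℕ) {X : Scheme.{u}} (i : X ⟶ prodProjSpace sB t) (hi : IsClosedImmersion i)
    (f : X ⟶ B) (hf : i ≫ pullback.fst sB (projSpaceToSpec k t) = f) (hflat : Flat f)
    -- its closed fibers are irreducible varieties over `k`
    (hfib : ∀ b : B, IsClosed {b} → IsIrreducibleVariety (f.fiberι b ≫ f ≫ sB))
    -- the projective variety `X₀ ⊆ ℙ^s`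
    (s : ℕ) {X₀ : Scheme.{u}} [IsIntegral X₀] (j : X₀ ⟶ projSpace k s) (hj : IsClosedImmersion j)
    -- all closed fibers are birational to `X₀` over `k`
    (hbir : ∀ b : B, IsClosed {b} →
      Scheme.BirationalOver (f.fiberι b ≫ f ≫ sB) (j ≫ projSpaceToSpec k s)) :
    BirationallyTrivialOnFiniteCover sB f (j ≫ projSpaceToSpec k s) ∧
      GeomGenericFiberBirational sB f (j ≫ projSpaceToSpec k s) := by

  have := hB.isSeparated
  have := hB.locallyOfFiniteType
  have hff : f = i ≫ pullback.fst sB (projSpaceToSpec k t) := hf.symm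
  have : LocallyOfFiniteType f := by rw [hff]; infer_instance
  have : QuasiCompact f := by rw [hff]; infer_instance
  have : IsSeparated f := by rw [hff]; infer_instance
  obtain ⟨R, _, _, _, _, _, _, ι, _, _, _, _, hι, hη⟩ := exists_affine_chart_geomGenericPoint sB
  obtain ⟨hirr, h⟩ := irreducibleSpace_and_birationalOver_of_forall_isClosed hk
    (E := AlgebraicClosure B.functionField) sB ι hι f (j ≫ projSpaceToSpec k s) hbir
  refine ⟨birationallyTrivialOnFiniteCover_of_birationalOver sB ι hι f _ rfl h, ?_⟩
  suffices key : ∀ x, x = Spec.map (CommRingCat.ofHom (algebraMap R _)) ≫ ι →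
      Scheme.BirationalOver (pullback.snd f x)
        (pullback.snd (j ≫ projSpaceToSpec k s) (x ≫ sB)) from key _ hη
  rintro _ rfl
  rw [Category.assoc, hι, ← Spec.map_comp, ← CommRingCat.ofHom_comp,
    ← IsScalarTower.algebraMap_eq]
  exact h
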